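/- Let $M\ge 1$ be the number of antennas and, for phases $\psi=(\psi_0,\dots,\psi_{M-1})\in[0,2\pi]^M$ with $\psi_0=0$ (call these admissible), put $\Phi_t=-t\pi\sin\phi$ and $$f(\psi,\phi)=\Big(1+\sum_{t=1}^{M-1}\cos(\psi_t+\Phi_t)\Big)^2+\Big(\sum_{t=1}^{M-1}\sin(\psi_t+\Phi_t)\Big)^2,\qquad f(\psi)=\frac1{2\pi}\int_0^{2\pi}f(\psi,\phi)\,d\phi .$$ Let $J_0(x)=\sum_{k\ge0}(-1)^k(x^2/4)^k/(k!)^2$ be the Bessel function of the first kind of order $0$. Then: 1. $f(\psi)=M+2\sum_{t=1}^{M-1}J_0(t\pi)\cos\psi_t+2\sum_{t=1}^{M-2}\sum_{l=t+1}^{M-1}J_0((t-l)\pi)\cos(\psi_t-\psi_l)$. 2. $f(\psi)\le M+2\sum_{t=1}^{M-1}|J_0(t\pi)|+2\sum_{t=1}^{M-2}\sum_{l=t+1}^{M-1}|J_0((t-l)\pi)|$ (both 1 and 2 hold for arbitrary real $\psi_t$), and equality holds for the admissible phases $\psi_t=\mathrm{mod}(t,2)\,\pi$, which therefore maximize $f$.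 3. An admissible $\psi$ maximizes $f$ over the admissible phases if and only if consecutive antennas are $\pi$ phase-shifted, that is, $\psi_{t+1}-\psi_t\equiv\pi \pmod{2\pi}$ for $0\le t\le M-2$. 4. Let $\beta>0$, $\kappa\ge0$, $\varphi_0\in\mathbb R$, let $R$ be a real symmetric positive semidefinite $M\times M$ matrix, let $\phi$ be uniform on $[0,2\pi]$ and let $z\sim\mathcal{CN}(0,R)$ be independent of $\phi$. Consider the equivalent channel vector $h^*_t=\sqrt{\tfrac{\kappa}{1+\kappa}}\,e^{i\varphi_0}e^{i(\Phi_t+\psi_t)}+\sqrt{\tfrac1{1+\kappa}}\,z_t$, $0\le t\le M-1$. If all antennas send the same signal (AA-SS), the incident RF energy is $\xi=\frac{\beta}{M}\big|\sum_t h^*_t\big|^2$. For every admissible $\psi$ it is integrable, with $$\mathbb E[\xi]=\frac{\beta}{M(\kappa+1)}\Big(\sum_{i,j}R_{ij}+\kappa f(\psi)\Big).$$ Hence $\psi_t=\mathrm{mod}(t,2)\,\pi$ maximizes $\mathbb E[\xi]$ over the admissible phases; and if $\kappa>0$, an admissible $\psi$ maximizes $\mathbb E[\xi]$ if and only if consecutive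 antennas are $\pi$ phase-shifted modulo $2\pi$. If $R$ is diagonal, $\mathbb E[\xi]$ is also the average incident RF energy of the phase-adjusted channel $\Psi h$, where $\Psi=\mathrm{diag}(e^{i\psi_0},\dots,e^{i\psi_{M-1}})$ and $h_t=\sqrt{\tfrac{\kappa}{1+\kappa}}\,e^{i\varphi_0}e^{i\Phi_t}+\sqrt{\tfrac1{1+\kappa}}\,z_t$. -/

import Mathlib

open MeasureTheory ProbabilityTheory

noncomputable section

namespace AASS

/-- Bessel function of the first kind of order `0`, by its power series. -/
def J0 (x : ℝ) : ℝ :=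
  ∑' k : ℕ, (-1 : ℝ) ^ k * (x ^ 2 / 4) ^ k / ((k.factorial : ℝ) ^ 2)

/-- Mean phase shift of the `t`-th element (counted from `0`) of a half-wavelength uniform linear
array, for azimuth `φ`. -/
def Phi (t : ℕ) (φ : ℝ) : ℝ := -(t : ℝ) * Real.pi * Real.sin φ

def upsilon1 (M : ℕ) (ψ : ℕ → ℝ) (φ : ℝ) : ℝ :=
  1 + ∑ t ∈ Finset.Icc 1 (M - 1), Real.cos (ψ t + Phi t φ)

def upsilon2 (M : ℕ) (ψ : ℕ → ℝ) (φ : ℝ) : ℝ :=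
  ∑ t ∈ Finset.Icc 1 (M - 1), Real.sin (ψ t + Phi t φ)

/-- `f(ψ, φ)`. -/
def fAt (M : ℕ) (ψ : ℕ → ℝ) (φ : ℝ) : ℝ := upsilon1 M ψ φ ^ 2 + upsilon2 M ψ φ ^ 2

/-- `f(ψ)`: the average of `f(ψ, φ)` over an azimuth `φ` uniform in `[0, 2π]`. -/
def fAvg (M : ℕ) (ψ : ℕ → ℝ) : ℝ :=
  1 / (2 * Real.pi) * ∫ φ in (0 : ℝ)..(2 * Real.pi), fAt M ψ φ

/-- The upper bound on `f(ψ)`, with `|J₀|` in place of `J₀` and every cosine replaced by `1`. -/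
def fUpper (M : ℕ) : ℝ :=
  (M : ℝ) + 2 * ∑ t ∈ Finset.Icc 1 (M - 1), |J0 ((t : ℝ) * Real.pi)|
    + 2 * ∑ t ∈ Finset.Icc 1 (M - 2), ∑ l ∈ Finset.Icc (t + 1) (M - 1),
        |J0 (((t : ℝ) - (l : ℝ)) * Real.pi)|

/-- The admissible phase vectors `(ψ₀, …, ψ_{M-1})`: `ψ₀ = 0` and all entries in `[0, 2π]`.
Entries with index at least `M` play no role. -/
def admissible (M : ℕ) : Set (ℕ → ℝ) :=
  {ψ | ψ 0 = 0 ∧ ∀ t < M, ψ t ∈ Set.Icc 0 (2 * Real.pi)}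

/-- The phase vector `ψ_t = mod(t, 2) π`. -/
def psiOpt (t : ℕ) : ℝ := ((t % 2 : ℕ) : ℝ) * Real.pi

/-- Consecutive antennas are phase-shifted by `π`, modulo `2π`. -/
def ConsecutivePiShifted (M : ℕ) (ψ : ℕ → ℝ) : Prop :=
  ∀ t : ℕ, t + 1 < M → ∃ k : ℤ, ψ (t + 1) - ψ t = Real.pi + 2 * Real.pi * (k : ℝ)

/-- The circularly-symmetric complex Gaussian law `CN(0, R)` with real covariance matrix `R`: real
and imaginary parts are independent, each with law `N(0, R / 2)`. -/
def complexGaussian {M : ℕ} (R : Matrix (Fin M) (Fin M) ℝ) : Measure (Fin M → ℂ) :=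
  ((multivariateGaussian 0 ((1 / 2 : ℝ) • R)).prod
    (multivariateGaussian 0 ((1 / 2 : ℝ) • R))).map
      (fun p j => (⟨p.1 j, p.2 j⟩ : ℂ))

/-- The joint law of the azimuth `φ`, uniform in `[0, 2π]`, and of an independent scattering
component with law `CN(0, R)`. -/
def jointLaw {M : ℕ} (R : Matrix (Fin M) (Fin M) ℝ) : Measure (ℝ × (Fin M → ℂ)) :=
  (cond (volume : Measure ℝ) (Set.Icc 0 (2 * Real.pi))).prod (complexGaussian R)

/-- The normalized Rician channel vector `h`, before any phase adjustment, with Rician factor `κ`,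
initial phase `φ₀`, azimuth `φ` and scattering component `z`. -/
def channel {M : ℕ} (κ φ₀ φ : ℝ) (z : Fin M → ℂ) : Fin M → ℂ := fun j =>
  (Real.sqrt (κ / (1 + κ)) : ℂ) * Complex.exp (Complex.I * (φ₀ : ℂ))
      * Complex.exp (Complex.I * (Phi (j : ℕ) φ : ℂ))
    + (Real.sqrt (1 / (1 + κ)) : ℂ) * z j

/-- The equivalent normalized channel vector `h*` under the phase adjustment `ψ`: the phases `ψ_t`
are added to the line-of-sight component and the scattering component has law `CN(0, R)`. -/
def equivChannel {M : ℕ} (κ φ₀ : ℝ) (ψ : ℕ → ℝ) (φ : ℝ) (z : Fin M → ℂ) : Fin M → ℂ := fun j =>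
  (Real.sqrt (κ / (1 + κ)) : ℂ) * Complex.exp (Complex.I * (φ₀ : ℂ))
      * Complex.exp (Complex.I * ((Phi (j : ℕ) φ + ψ (j : ℕ) : ℝ) : ℂ))
    + (Real.sqrt (1 / (1 + κ)) : ℂ) * z j

/-- The diagonal matrix `Ψ` of the phase adjustment, applied to a channel vector. -/
def applyPsi {M : ℕ} (ψ : ℕ → ℝ) (h : Fin M → ℂ) : Fin M → ℂ := fun j =>
  Complex.exp (Complex.I * (ψ (j : ℕ) : ℂ)) * h j

/-- Incident RF energy when all antennas transmit the same signal over the channel `h`. -/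
def rfEnergy {M : ℕ} (β : ℝ) (h : Fin M → ℂ) : ℝ := β / (M : ℝ) * ‖∑ j, h j‖ ^ 2

/-- Average incident RF energy, over azimuth and fading, for the equivalent channel. -/
def avgRFEnergy {M : ℕ} (β κ φ₀ : ℝ) (R : Matrix (Fin M) (Fin M) ℝ) (ψ : ℕ → ℝ) : ℝ :=
  ∫ p, rfEnergy β (equivChannel κ φ₀ ψ p.1 p.2) ∂(jointLaw R)

end AASS

end

/-!
With `ψ_0 = 0`, expanding the squared modulus of `∑ t < M, exp (i (Φ_t + ψ_t))` and averaging over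
the azimuth gives `f(ψ) = ∑ i, j < M, J₀((i - j)π) cos (ψ_i - ψ_j)`, with both indices running from
`0`. The sign of `J₀(kπ)` is `(-1)^k`: the integral of `cos (kπ (1 - cos θ))` over `[0, π / 2]` is
`(-1)^k (π / 2) J₀(kπ)`, and for every `a > 0` two integrations by parts turn the integral of
`cos (a (1 - cos θ))` into `sin a / a` plus the integral of the nonnegative function
`(1 - cos (a (1 - cos θ))) (1 + 2 cos² θ) / (a² sin⁴ θ)`, which is not identically zero. Hence, with
`δ_t = ψ_t - tπ`, `f(ψ)` becomes `∑ i, j < M, |J₀((i - j)π)| cos (δ_i - δ_j)` with all weights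
positive, which is largest exactly when the `δ_t` agree modulo `2π`.

For the energy, the scattering component is centred and independent of the azimuth, hence
orthogonal in `L²` to the line-of-sight component, so that the two second moments add up.
-/

namespace AASS

section Bessel

open Real

theorem prod_range_odd_div_even (n : ℕ) :
    ∏ i ∈ Finset.range n, (2 * (i : ℝ) + 1) / (2 * i + 2) =
      ((2 * n).factorial : ℝ) / (4 ^ n * (n.factorial : ℝ) ^ 2) := by
  induction n with
  | zero => simp
  | succ k ih =>
    have := Nat.factorial_ne_zero k
    rw [Finset.prod_range_succ, ih, show 2 * (k + 1) = 2 * k + 1 + 1 by ring,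
      Nat.factorial_succ, Nat.factorial_succ, Nat.factorial_succ]
    push_cast
    field_simp
    ring

theorem integral_comp_sin_zero_pi {g : ℝ → ℝ} (hg : Continuous g) :
    ∫ θ in (0 : ℝ)..π, g (sin θ) = 2 * ∫ θ in (0 : ℝ)..(π / 2), g (cos θ) := by
  have hint (a b : ℝ) : IntervalIntegrable (fun θ => g (sin θ)) volume a b :=
    (hg.comp continuous_sin).intervalIntegrable a b
  have hleft : ∫ θ in (0 : ℝ)..(π / 2), g (sin θ) = ∫ θ in (0 : ℝ)..(π / 2), g (cos θ) := by
    simpa [sin_pi_div_two_sub] using (intervalIntegral.integral_comp_sub_left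
      (a := 0) (b := π / 2) (fun θ => g (sin θ)) (π / 2)).symm
  have hright : ∫ θ in (π / 2)..π, g (sin θ) = ∫ θ in (0 : ℝ)..(π / 2), g (cos θ) := by
    simpa [sin_add_pi_div_two, add_halves] using (intervalIntegral.integral_comp_add_right
      (a := 0) (b := π / 2) (fun θ => g (sin θ)) (π / 2)).symm
  rw [← intervalIntegral.integral_add_adjacent_intervals (hint 0 (π / 2)) (hint (π / 2) π),
    hleft, hright, two_mul]

theorem integral_comp_sin_zero_two_pi {g : ℝ → ℝ} (hg : Continuous g) :
    ∫ θ in (0 : ℝ)..(2 * π), g (sin θ) = ∫ θ in (0 : ℝ)..π, (g (sin θ) + g (-sin θ)) := by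
  have hint (a b : ℝ) : IntervalIntegrable (fun θ => g (sin θ)) volume a b :=
    (hg.comp continuous_sin).intervalIntegrable a b
  have hright : ∫ θ in π..(2 * π), g (sin θ) = ∫ θ in (0 : ℝ)..π, g (-sin θ) := by
    simpa [sin_add_pi, two_mul] using (intervalIntegral.integral_comp_add_right
      (a := 0) (b := π) (fun θ => g (sin θ)) π).symm
  rw [← intervalIntegral.integral_add_adjacent_intervals (hint 0 π) (hint π (2 * π)), hright,
    intervalIntegral.integral_add (hint 0 π) (Continuous.intervalIntegrable (by fun_prop) 0 π)]

theorem integral_cos_mul_sin_zero_pi (x : ℝ) :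
    ∫ θ in (0 : ℝ)..π, cos (x * sin θ) = π * J0 x := by
  have hseries : HasSum
      (fun n : ℕ => ∫ θ in (0 : ℝ)..π,
        (-1 : ℝ) ^ n * (x * sin θ) ^ (2 * n) / ((2 * n).factorial : ℝ))
      (∫ θ in (0 : ℝ)..π, cos (x * sin θ)) := by
    refine intervalIntegral.hasSum_integral_of_dominated_convergence
      (fun n _ => |x| ^ (2 * n) / ((2 * n).factorial : ℝ))
      (fun n => Continuous.aestronglyMeasurable (by fun_prop))
      (fun n => .of_forall fun θ _ => ?_)
      (.of_forall fun θ _ => (hasSum_cosh |x|).summable) intervalIntegrable_const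
      (.of_forall fun θ _ => hasSum_cos (x * sin θ))
    have hsin : |x * sin θ| ≤ |x| := by
      rw [abs_mul]
      exact mul_le_of_le_one_right (abs_nonneg x) (abs_sin_le_one θ)
    simp only [norm_div, norm_mul, norm_pow, norm_neg, norm_one, one_pow, one_mul, norm_eq_abs,
      Nat.abs_cast] at hsin ⊢
    rw [← abs_mul]
    gcongr
  rw [← hseries.tsum_eq, J0, ← tsum_mul_left]
  refine tsum_congr fun n => ?_
  have hpull (θ : ℝ) : (-1 : ℝ) ^ n * (x * sin θ) ^ (2 * n) / ((2 * n).factorial : ℝ) =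
      (-1 : ℝ) ^ n * x ^ (2 * n) / ((2 * n).factorial : ℝ) * sin θ ^ (2 * n) := by ring
  simp_rw [hpull]
  rw [intervalIntegral.integral_const_mul, integral_sin_pow_even, prod_range_odd_div_even,
    div_pow, ← pow_mul]
  have := Nat.factorial_ne_zero (2 * n)
  field_simp

theorem integral_cos_add_mul_sin_zero_two_pi (α x : ℝ) :
    ∫ θ in (0 : ℝ)..(2 * π), cos (α + x * sin θ) = 2 * π * (J0 x * cos α) := by
  have hpair (θ : ℝ) : cos (α + x * sin θ) + cos (α + x * -sin θ) =
      2 * cos α * cos (x * sin θ) := by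
    rw [mul_neg, ← sub_eq_add_neg, cos_add, cos_sub]
    ring
  rw [integral_comp_sin_zero_two_pi (g := fun s => cos (α + x * s)) (by fun_prop)]
  simp_rw [hpair]
  rw [intervalIntegral.integral_const_mul, integral_cos_mul_sin_zero_pi]
  ring

theorem integral_cos_mul_cos_zero_pi_div_two (x : ℝ) :
    ∫ θ in (0 : ℝ)..(π / 2), cos (x * cos θ) = π / 2 * J0 x := by
  have h := integral_comp_sin_zero_pi (g := fun s => cos (x * s)) (by fun_prop)
  rw [integral_cos_mul_sin_zero_pi] at h
  linarith

theorem J0_zero : J0 0 = 1 := by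
  have h := integral_cos_mul_sin_zero_pi 0
  simpa [pi_ne_zero] using h.symm

theorem J0_neg (x : ℝ) : J0 (-x) = J0 x := by
  simp only [J0, neg_sq]

/-- The boundary term left by integrating `cos (a * (1 - cos θ))` by parts twice. For `sin θ ≠ 0` it
is the quotient in `boundaryTerm_eq`; the cardinal sine removes the singularity at `θ = 0`. -/
noncomputable def boundaryTerm (a θ : ℝ) : ℝ :=
  sin θ / (1 + cos θ) * (sinc (a * (1 - cos θ)) +
    sinc (a * (1 - cos θ) / 2) ^ 2 * cos θ / (2 * (1 + cos θ)))

theorem boundaryTerm_eq {a θ : ℝ} (ha : a ≠ 0) (hθ : sin θ ≠ 0) :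
    boundaryTerm a θ = sin (a * (1 - cos θ)) / (a * sin θ) +
      (1 - cos (a * (1 - cos θ))) * cos θ / (a ^ 2 * sin θ ^ 3) := by
  have hsq : sin θ ^ 2 = (1 - cos θ) * (1 + cos θ) := by rw [sin_sq]; ring
  have hprod : (1 - cos θ) * (1 + cos θ) ≠ 0 := hsq ▸ pow_ne_zero 2 hθ
  obtain ⟨hminus, hplus⟩ := mul_ne_zero_iff.1 hprod
  have hhalf : 1 - cos (a * (1 - cos θ)) = 2 * sin (a * (1 - cos θ) / 2) ^ 2 := by
    rw [sin_sq_eq_half_sub, mul_div_cancel₀ _ (two_ne_zero' ℝ)]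
    ring
  have hfourth : sin θ ^ 4 = ((1 - cos θ) * (1 + cos θ)) ^ 2 := by rw [← hsq]; ring
  rw [boundaryTerm, sinc_of_ne_zero (mul_ne_zero ha hminus),
    sinc_of_ne_zero (div_ne_zero (mul_ne_zero ha hminus) two_ne_zero), hhalf]
  field_simp
  rw [hfourth, hsq]
  ring

theorem continuousOn_boundaryTerm (a : ℝ) : ContinuousOn (boundaryTerm a) (Set.Icc 0 (π / 2)) := by
  have hne : ∀ θ ∈ Set.Icc 0 (π / 2), 1 + cos θ ≠ 0 := fun θ hθ => by
    have := cos_nonneg_of_neg_pi_div_two_le_of_le (by linarith [hθ.1, pi_pos]) hθ.2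
    positivity
  have hsinc : Continuous fun θ => sinc (a * (1 - cos θ)) := continuous_sinc.comp (by fun_prop)
  have hsinc_half : Continuous fun θ => sinc (a * (1 - cos θ) / 2) :=
    continuous_sinc.comp (by fun_prop)
  exact (continuousOn_sin.div (by fun_prop) hne).mul (hsinc.continuousOn.add
    (((hsinc_half.pow 2).mul continuous_cos).continuousOn.div (by fun_prop)
      fun θ hθ => mul_ne_zero two_ne_zero (hne θ hθ)))

theorem hasDerivAt_boundaryTerm {a θ : ℝ} (ha : a ≠ 0) (hθ : sin θ ≠ 0) :
    HasDerivAt (boundaryTerm a)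
      (cos (a * (1 - cos θ)) -
        (1 - cos (a * (1 - cos θ))) * (1 + 2 * cos θ ^ 2) / (a ^ 2 * sin θ ^ 4)) θ := by
  have hphase : HasDerivAt (fun θ => a * (1 - cos θ)) (a * sin θ) θ := by
    simpa using ((hasDerivAt_cos θ).const_sub 1).const_mul a
  have hfirst := hphase.sin.fun_div ((hasDerivAt_sin θ).const_mul a) (mul_ne_zero ha hθ)
  have hsecond := ((hphase.cos.const_sub 1).fun_mul (hasDerivAt_cos θ)).fun_div
    (((hasDerivAt_sin θ).fun_pow 3).const_mul (a ^ 2)) (by positivity)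
  have hquot : boundaryTerm a =ᶠ[nhds θ] fun θ => sin (a * (1 - cos θ)) / (a * sin θ) +
      (1 - cos (a * (1 - cos θ))) * cos θ / (a ^ 2 * sin θ ^ 3) :=
    (continuous_sin.continuousAt.eventually_ne hθ).mono fun _ => boundaryTerm_eq ha
  refine ((hfirst.fun_add hsecond).congr_of_eventuallyEq hquot).congr_deriv ?_
  have hsq : cos θ ^ 2 = 1 - sin θ ^ 2 := cos_sq' θ
  field_simp
  ring_nf
  simp only [hsq]
  ring

theorem lt_of_monotoneOn_of_hasDerivAt_pos {f : ℝ → ℝ} {a b c f' : ℝ}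
    (hf : MonotoneOn f (Set.Icc a b)) (hc : c ∈ Set.Ioo a b) (hderiv : HasDerivAt f f' c)
    (hpos : 0 < f') : f a < f b := by
  have hab : a ≤ b := (hc.1.trans hc.2).le
  refine (hf (Set.left_mem_Icc.2 hab) (Set.right_mem_Icc.2 hab) hab).lt_of_ne fun hends => ?_
  have hconst : f =ᶠ[nhds c] fun _ => f a := by
    filter_upwards [Icc_mem_nhds hc.1 hc.2] with x hx
    exact le_antisymm ((hf hx (Set.right_mem_Icc.2 hab) hx.2).trans hends.ge)
      (hf (Set.left_mem_Icc.2 hab) hx hx.1)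
  exact hpos.ne' (hderiv.unique ((hasDerivAt_const c (f a)).congr_of_eventuallyEq hconst))

theorem exists_mem_Ioo_cos_mul_one_sub_cos_lt_one {a : ℝ} (ha : 0 < a) :
    ∃ θ ∈ Set.Ioo 0 (π / 2), cos (a * (1 - cos θ)) < 1 := by
  have hpos : 0 < a / (1 + a) := by positivity
  have hlt : a / (1 + a) < 1 := (div_lt_one (by positivity)).2 (by linarith)
  have hphase : a * (1 - cos (arccos (a / (1 + a)))) = a / (1 + a) := by
    rw [cos_arccos (by linarith) hlt.le]
    field_simp
    ring
  refine ⟨arccos (a / (1 + a)), ⟨arccos_pos.2 hlt, arccos_lt_pi_div_two.2 hpos⟩, ?_⟩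
  simpa [hphase] using cos_lt_cos_of_nonneg_of_le_pi le_rfl (by linarith [pi_gt_three]) hpos

theorem sin_div_lt_integral_cos_mul_one_sub_cos {a : ℝ} (ha : 0 < a) :
    sin a / a < ∫ θ in (0 : ℝ)..(π / 2), cos (a * (1 - cos θ)) := by
  set K : ℝ → ℝ := fun x => (∫ θ in (0 : ℝ)..x, cos (a * (1 - cos θ))) - boundaryTerm a x with hK
  have hcos : Continuous fun θ => cos (a * (1 - cos θ)) := by fun_prop
  have hsin : ∀ x ∈ Set.Ioo 0 (π / 2), 0 < sin x := fun x hx =>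
    sin_pos_of_pos_of_lt_pi hx.1 (by linarith [hx.2, pi_pos])
  have hderiv : ∀ x ∈ Set.Ioo 0 (π / 2), HasDerivAt K
      ((1 - cos (a * (1 - cos x))) * (1 + 2 * cos x ^ 2) / (a ^ 2 * sin x ^ 4)) x := fun x hx =>
    ((hcos.integral_hasStrictDerivAt 0 x).hasDerivAt.sub
      (hasDerivAt_boundaryTerm ha.ne' (hsin x hx).ne')).congr_deriv (by ring)
  have hmono : MonotoneOn K (Set.Icc 0 (π / 2)) := by
    refine monotoneOn_of_hasDerivWithinAt_nonneg (convex_Icc _ _)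
      ((intervalIntegral.continuous_primitive (fun _ _ => hcos.intervalIntegrable _ _)
        0).continuousOn.sub (continuousOn_boundaryTerm a))
      (fun x hx => (hderiv x (by rwa [interior_Icc] at hx)).hasDerivWithinAt) fun x _ => ?_
    have := sub_nonneg.2 (cos_le_one (a * (1 - cos x)))
    positivity
  obtain ⟨c, hc, hphase⟩ := exists_mem_Ioo_cos_mul_one_sub_cos_lt_one ha
  have hlt : K 0 < K (π / 2) := lt_of_monotoneOn_of_hasDerivAt_pos hmono hc (hderiv c hc)
    (by have := hsin c hc; have := sub_pos.2 hphase; positivity)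
  have hpi : boundaryTerm a (π / 2) = sin a / a := by
    simp [boundaryTerm, sinc_of_ne_zero ha.ne']
  have hzero : boundaryTerm a 0 = 0 := by simp [boundaryTerm]
  simpa [hK, hpi, hzero] using hlt

theorem neg_one_pow_mul_J0_nat_mul_pi_pos (n : ℕ) : 0 < (-1 : ℝ) ^ n * J0 (n * π) := by
  rcases n.eq_zero_or_pos with rfl | hn
  · simp [J0_zero]
  have hlt := sin_div_lt_integral_cos_mul_one_sub_cos (a := n * π) (by positivity)
  have hshift (θ : ℝ) : cos (n * π * (1 - cos θ)) = (-1) ^ n * cos (n * π * cos θ) := by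
    rw [mul_one_sub, cos_nat_mul_pi_sub]
  simp_rw [hshift] at hlt
  rw [intervalIntegral.integral_const_mul, integral_cos_mul_cos_zero_pi_div_two, sin_nat_mul_pi,
    zero_div, mul_left_comm] at hlt
  exact pos_of_mul_pos_right hlt (by positivity)

theorem neg_one_zpow_mul_J0_int_mul_pi_pos (k : ℤ) : 0 < (-1 : ℝ) ^ k * J0 (k * π) := by
  obtain ⟨n, rfl | rfl⟩ := k.eq_nat_or_neg
  · simpa using neg_one_pow_mul_J0_nat_mul_pi_pos n
  · simpa [J0_neg, ← inv_pow] using neg_one_pow_mul_J0_nat_mul_pi_pos n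

theorem J0_int_mul_pi_ne_zero (k : ℤ) : J0 (k * π) ≠ 0 :=
  right_ne_zero_of_mul (neg_one_zpow_mul_J0_int_mul_pi_pos k).ne'

theorem abs_J0_int_mul_pi (k : ℤ) : |J0 (k * π)| = (-1 : ℝ) ^ k * J0 (k * π) := by
  rw [← abs_of_pos (neg_one_zpow_mul_J0_int_mul_pi_pos k), abs_mul, abs_neg_one_zpow, one_mul]

theorem J0_int_mul_pi_mul_cos (k : ℤ) (x : ℝ) :
    J0 (k * π) * cos x = |J0 (k * π)| * cos (x - k * π) := by
  have hsign : (-1 : ℝ) ^ k * (-1) ^ k = 1 := by rw [← mul_zpow]; simp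
  rw [abs_J0_int_mul_pi, cos_sub_int_mul_pi]
  linear_combination (-(J0 (k * π) * cos x)) * hsign

end Bessel

section Array

open Real

variable {M : ℕ} {ψ : ℕ → ℝ}

theorem norm_exp_I_mul_ofReal (x : ℝ) : ‖Complex.exp (Complex.I * x)‖ = 1 := by
  rw [mul_comm, Complex.norm_exp_ofReal_mul_I]

theorem inner_exp_I_mul_ofReal (x y : ℝ) :
    inner ℝ (Complex.exp (Complex.I * x)) (Complex.exp (Complex.I * y)) = cos (x - y) := by
  simp only [Complex.inner, Complex.mul_re, Complex.conj_re, Complex.conj_im,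
    mul_comm Complex.I, Complex.exp_ofReal_mul_I_re, Complex.exp_ofReal_mul_I_im, cos_sub]
  ring

/-- The sum of the line-of-sight components of the `M` antennas under the phase adjustment `ψ`,
without their common factor, so that the average of its squared modulus over `φ` is `fAvg M ψ`. -/
noncomputable def steeringSum (M : ℕ) (ψ : ℕ → ℝ) (φ : ℝ) : ℂ :=
  ∑ j ∈ Finset.range M, Complex.exp (Complex.I * (Phi j φ + ψ j : ℝ))

theorem continuous_steeringSum (M : ℕ) (ψ : ℕ → ℝ) : Continuous (steeringSum M ψ) := by
  unfold steeringSum Phi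
  fun_prop

theorem norm_steeringSum_le (M : ℕ) (ψ : ℕ → ℝ) (φ : ℝ) : ‖steeringSum M ψ φ‖ ≤ M := by
  refine (norm_sum_le _ _).trans_eq ?_
  simp only [norm_exp_I_mul_ofReal, Finset.sum_const, Finset.card_range, nsmul_one]

theorem sq_norm_steeringSum_eq_sum_sum (M : ℕ) (ψ : ℕ → ℝ) (φ : ℝ) :
    ‖steeringSum M ψ φ‖ ^ 2 = ∑ i ∈ Finset.range M, ∑ j ∈ Finset.range M,
      cos (ψ i - ψ j + -(((i : ℝ) - j) * π) * sin φ) := by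
  rw [steeringSum, ← real_inner_self_eq_norm_sq]
  simp_rw [sum_inner, inner_sum, inner_exp_I_mul_ofReal, Phi]
  refine Finset.sum_congr rfl fun i _ => Finset.sum_congr rfl fun j _ => congrArg cos ?_
  ring

theorem sum_range_eq_zero_add_sum_Icc {A : Type*} [AddCommMonoid A] (hM : 1 ≤ M) (g : ℕ → A) :
    ∑ j ∈ Finset.range M, g j = g 0 + ∑ t ∈ Finset.Icc 1 (M - 1), g t := by
  obtain ⟨n, rfl⟩ := Nat.exists_eq_add_of_le' hM
  rw [Finset.range_eq_Ico, Finset.sum_eq_sum_Ico_succ_bot (by omega)]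
  rfl

theorem sq_norm_steeringSum (hM : 1 ≤ M) (h0 : ψ 0 = 0) (φ : ℝ) :
    ‖steeringSum M ψ φ‖ ^ 2 = fAt M ψ φ := by
  have hre : (steeringSum M ψ φ).re = upsilon1 M ψ φ := by
    simp_rw [steeringSum, Complex.re_sum, mul_comm Complex.I, Complex.exp_ofReal_mul_I_re,
      sum_range_eq_zero_add_sum_Icc hM, upsilon1]
    simp [h0, Phi, add_comm]
  have him : (steeringSum M ψ φ).im = upsilon2 M ψ φ := by
    simp_rw [steeringSum, Complex.im_sum, mul_comm Complex.I, Complex.exp_ofReal_mul_I_im,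
      sum_range_eq_zero_add_sum_Icc hM, upsilon2]
    simp [h0, Phi, add_comm]
  rw [Complex.sq_norm, Complex.normSq_apply, hre, him, fAt, sq, sq]

theorem fAvg_eq_sum_sum (hM : 1 ≤ M) (h0 : ψ 0 = 0) :
    fAvg M ψ = ∑ i ∈ Finset.range M, ∑ j ∈ Finset.range M,
      J0 (((i : ℝ) - j) * π) * cos (ψ i - ψ j) := by
  simp_rw [fAvg, ← sq_norm_steeringSum hM h0, sq_norm_steeringSum_eq_sum_sum]
  rw [intervalIntegral.integral_finsetSum
    fun _ _ => Continuous.intervalIntegrable (by fun_prop) _ _, Finset.mul_sum]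
  refine Finset.sum_congr rfl fun i _ => ?_
  rw [intervalIntegral.integral_finsetSum
    fun _ _ => Continuous.intervalIntegrable (by fun_prop) _ _, Finset.mul_sum]
  refine Finset.sum_congr rfl fun j _ => ?_
  rw [integral_cos_add_mul_sin_zero_two_pi, J0_neg, one_div, inv_mul_cancel_left₀ (by positivity)]

theorem fAvg_update_zero (M : ℕ) (ψ : ℕ → ℝ) (x : ℝ) :
    fAvg M (Function.update ψ 0 x) = fAvg M ψ := by
  have hne {t : ℕ} (ht : t ∈ Finset.Icc 1 (M - 1)) : Function.update ψ 0 x t = ψ t :=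
    Function.update_of_ne (by grind) _ _
  have h1 (φ : ℝ) : upsilon1 M (Function.update ψ 0 x) φ = upsilon1 M ψ φ :=
    congrArg (1 + ·) (Finset.sum_congr rfl fun t ht => by rw [hne ht])
  have h2 (φ : ℝ) : upsilon2 M (Function.update ψ 0 x) φ = upsilon2 M ψ φ :=
    Finset.sum_congr rfl fun t ht => by rw [hne ht]
  simp_rw [fAvg, fAt, h1, h2]

theorem sum_Icc_sum_Icc_succ {A : Type*} [AddCommMonoid A] (g : ℕ → ℕ → A) (n : ℕ) :
    ∑ t ∈ Finset.Icc 1 n, ∑ l ∈ Finset.Icc (t + 1) (n + 1), g t l =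
      ∑ t ∈ Finset.Icc 1 (n - 1), ∑ l ∈ Finset.Icc (t + 1) n, g t l
        + ∑ t ∈ Finset.Icc 1 n, g t (n + 1) := by
  have htop : ∀ t ∈ Finset.Icc 1 n, ∑ l ∈ Finset.Icc (t + 1) (n + 1), g t l =
      ∑ l ∈ Finset.Icc (t + 1) n, g t l + g t (n + 1) := fun t ht =>
    Finset.sum_Icc_succ_top (by grind) _
  rw [Finset.sum_congr rfl htop, Finset.sum_add_distrib]
  congr 1
  cases n with
  | zero => simp
  | succ m => rw [Finset.sum_Icc_succ_top (by omega)]; simp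

theorem sum_range_sum_range_of_symm {A : Type*} [CommRing A] {g : ℕ → ℕ → A}
    (hg : ∀ i j, g i j = g j i) (hM : 1 ≤ M) :
    ∑ i ∈ Finset.range M, ∑ j ∈ Finset.range M, g i j =
      ∑ i ∈ Finset.range M, g i i + 2 * ∑ t ∈ Finset.Icc 1 (M - 1), g t 0
        + 2 * ∑ t ∈ Finset.Icc 1 (M - 2), ∑ l ∈ Finset.Icc (t + 1) (M - 1), g t l := by
  induction M, hM using Nat.le_induction with
  | base => simp
  | succ M hM ih =>
    obtain ⟨n, rfl⟩ := Nat.exists_eq_add_of_le' hM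
    have hborder : ∑ j ∈ Finset.range (n + 1), g j (n + 1) =
        g (n + 1) 0 + ∑ t ∈ Finset.Icc 1 n, g t (n + 1) := by
      rw [sum_range_eq_zero_add_sum_Icc hM, hg 0, Nat.add_sub_cancel]
    have hsquare : ∑ i ∈ Finset.range (n + 2), ∑ j ∈ Finset.range (n + 2), g i j =
        ∑ i ∈ Finset.range (n + 1), ∑ j ∈ Finset.range (n + 1), g i j
          + 2 * ∑ j ∈ Finset.range (n + 1), g j (n + 1) + g (n + 1) (n + 1) := by
      simp only [Finset.sum_range_succ _ (n + 1), Finset.sum_add_distrib, hg (n + 1)]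
      ring
    have hdiag := Finset.sum_range_succ (fun i => g i i) (n + 1)
    have hzero := Finset.sum_Icc_succ_top (Nat.le_add_left 1 n) fun t => g t 0
    have htriangle := sum_Icc_sum_Icc_succ g n
    simp only [Nat.add_sub_cancel, Nat.reduceSubDiff] at ih ⊢
    linear_combination hsquare + ih + 2 * hborder - hdiag - 2 * hzero - 2 * htriangle

theorem fAvg_eq (hM : 1 ≤ M) (ψ : ℕ → ℝ) : fAvg M ψ =
    (M : ℝ) + 2 * ∑ t ∈ Finset.Icc 1 (M - 1), J0 ((t : ℝ) * π) * cos (ψ t)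
      + 2 * ∑ t ∈ Finset.Icc 1 (M - 2), ∑ l ∈ Finset.Icc (t + 1) (M - 1),
          J0 (((t : ℝ) - (l : ℝ)) * π) * cos (ψ t - ψ l) := by
  have hψ {t : ℕ} (ht : 1 ≤ t) : Function.update ψ 0 0 t = ψ t :=
    Function.update_of_ne (by omega) _ _
  rw [← fAvg_update_zero M ψ 0, fAvg_eq_sum_sum hM (by simp), sum_range_sum_range_of_symm _ hM]
  · congr 2
    · simp [J0_zero]
    · refine congrArg (2 * ·) (Finset.sum_congr rfl fun t ht => ?_)
      simp [hψ (Finset.mem_Icc.1 ht).1]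
    · refine Finset.sum_congr rfl fun t ht => ?_
      refine Finset.sum_congr rfl fun l hl => ?_
      rw [hψ (Finset.mem_Icc.1 ht).1, hψ ((Nat.le_add_left 1 t).trans (Finset.mem_Icc.1 hl).1)]
  · intro i j
    rw [← neg_sub (i : ℝ) j, neg_mul, J0_neg, ← cos_neg, neg_sub]

theorem fUpper_eq_sum_sum (hM : 1 ≤ M) : fUpper M =
    ∑ i ∈ Finset.range M, ∑ j ∈ Finset.range M, |J0 (((i : ℝ) - j) * π)| := by
  rw [sum_range_sum_range_of_symm _ hM]
  · simp [fUpper, J0_zero]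
  · intro i j
    rw [← neg_sub (i : ℝ) j, neg_mul, J0_neg]

theorem J0_sub_mul_pi_mul_cos (i j : ℕ) (x y : ℝ) :
    J0 (((i : ℝ) - j) * π) * cos (x - y) =
      |J0 (((i : ℝ) - j) * π)| * cos (x - i * π - (y - j * π)) := by
  have h := J0_int_mul_pi_mul_cos ((i : ℤ) - j) (x - y)
  push_cast at h
  rw [h]
  ring_nf

theorem fUpper_sub_fAvg (hM : 1 ≤ M) (h0 : ψ 0 = 0) :
    fUpper M - fAvg M ψ = ∑ i ∈ Finset.range M, ∑ j ∈ Finset.range M,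
      |J0 (((i : ℝ) - j) * π)| * (1 - cos (ψ i - i * π - (ψ j - j * π))) := by
  simp_rw [fUpper_eq_sum_sum hM, fAvg_eq_sum_sum hM h0, J0_sub_mul_pi_mul_cos,
    ← Finset.sum_sub_distrib, mul_one_sub]

theorem fAvg_le_fUpper (hM : 1 ≤ M) (ψ : ℕ → ℝ) : fAvg M ψ ≤ fUpper M := by
  rw [← fAvg_update_zero M ψ 0, ← sub_nonneg, fUpper_sub_fAvg hM (by simp)]
  exact Finset.sum_nonneg fun i _ => Finset.sum_nonneg fun j _ =>
    mul_nonneg (abs_nonneg _) (sub_nonneg.2 (cos_le_one _))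

theorem consecutivePiShifted_iff_cos : ConsecutivePiShifted M ψ ↔
    ∀ i < M, ∀ j < M, cos (ψ i - i * π - (ψ j - j * π)) = 1 := by
  constructor
  · intro h
    have hconst (i : ℕ) (hi : i < M) : ((ψ i - i * π : ℝ) : Angle) = (ψ 0 : ℝ) := by
      induction i with
      | zero => simp
      | succ i ih =>
        obtain ⟨k, hk⟩ := h i hi
        rw [← ih (by omega), Angle.angle_eq_iff_two_pi_dvd_sub]
        exact ⟨k, by push_cast; linarith⟩
    intro i hi j hj
    rw [← Angle.cos_coe, Angle.coe_sub, hconst i hi, hconst j hj, sub_self, Angle.cos_zero]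
  · intro h t ht
    obtain ⟨k, hk⟩ := (cos_eq_one_iff _).1 (h (t + 1) ht t (by omega))
    exact ⟨k, by push_cast at hk; linarith⟩

theorem fAvg_eq_fUpper_iff (hM : 1 ≤ M) (h0 : ψ 0 = 0) :
    fAvg M ψ = fUpper M ↔ ConsecutivePiShifted M ψ := by
  have hnonneg (i j : ℕ) :
      0 ≤ |J0 (((i : ℝ) - j) * π)| * (1 - cos (ψ i - i * π - (ψ j - j * π))) :=
    mul_nonneg (abs_nonneg _) (sub_nonneg.2 (cos_le_one _))
  have hJ (i j : ℕ) : J0 (((i : ℝ) - j) * π) ≠ 0 := by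
    exact_mod_cast J0_int_mul_pi_ne_zero ((i : ℤ) - j)
  rw [eq_comm, ← sub_eq_zero, fUpper_sub_fAvg hM h0, consecutivePiShifted_iff_cos,
    Finset.sum_eq_zero_iff_of_nonneg fun i _ => Finset.sum_nonneg fun j _ => hnonneg i j]
  simp_rw [Finset.sum_eq_zero_iff_of_nonneg fun j _ => hnonneg _ j, mul_eq_zero, abs_eq_zero, hJ,
    false_or, sub_eq_zero, Finset.mem_range, eq_comm]

theorem consecutivePiShifted_psiOpt (M : ℕ) : ConsecutivePiShifted M psiOpt := by
  intro t _
  rcases Nat.mod_two_eq_zero_or_one t with h | h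
  · exact ⟨0, by simp [psiOpt, Nat.add_mod, h]⟩
  · exact ⟨-1, by simp [psiOpt, Nat.add_mod, h]; ring⟩

theorem psiOpt_mem_admissible (M : ℕ) : psiOpt ∈ admissible M := by
  refine ⟨by simp [psiOpt], fun t _ => ?_⟩
  rcases Nat.mod_two_eq_zero_or_one t with h | h <;> simp [psiOpt, h, pi_pos.le, two_mul]

theorem fAvg_psiOpt (hM : 1 ≤ M) : fAvg M psiOpt = fUpper M :=
  (fAvg_eq_fUpper_iff hM (psiOpt_mem_admissible M).1).2 (consecutivePiShifted_psiOpt M)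

theorem isMaxOn_fAvg_psiOpt (hM : 1 ≤ M) : IsMaxOn (fAvg M) (admissible M) psiOpt :=
  fun ψ _ => (fAvg_le_fUpper hM ψ).trans_eq (fAvg_psiOpt hM).symm

theorem isMaxOn_fAvg_iff (hM : 1 ≤ M) (hψ : ψ ∈ admissible M) :
    IsMaxOn (fAvg M) (admissible M) ψ ↔ ConsecutivePiShifted M ψ := by
  rw [← fAvg_eq_fUpper_iff hM hψ.1]
  constructor
  · intro hmax
    exact (fAvg_le_fUpper hM ψ).antisymm
      ((fAvg_psiOpt hM).symm.trans_le (hmax (psiOpt_mem_admissible M)))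
  · intro heq ψ' _
    exact (fAvg_le_fUpper hM ψ').trans_eq heq.symm

end Array

section SecondMoment

open scoped InnerProductSpace

variable {Ω Ω' E : Type*} {mΩ : MeasurableSpace Ω} {mΩ' : MeasurableSpace Ω'}
  [NormedAddCommGroup E] [InnerProductSpace ℝ E]
  {μ : Measure Ω} {ν : Measure Ω'} [IsProbabilityMeasure μ] [IsProbabilityMeasure ν]

theorem integral_sq_norm_add_prod [CompleteSpace E] {X : Ω → E} {Y : Ω' → E} (hX : MemLp X 2 μ)
    (hY : MemLp Y 2 ν) (hY0 : ∫ y, Y y ∂ν = 0) :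
    ∫ p, ‖X p.1 + Y p.2‖ ^ 2 ∂(μ.prod ν) = ∫ x, ‖X x‖ ^ 2 ∂μ + ∫ y, ‖Y y‖ ^ 2 ∂ν := by
  have hXi : Integrable X μ := hX.integrable one_le_two
  have hYi : Integrable Y ν := hY.integrable one_le_two
  have hcross : ∫ p, ⟪X p.1, Y p.2⟫_ℝ ∂(μ.prod ν) = 0 :=
    (integral_prod_bilin (innerSL ℝ) hXi hYi).trans (by simp [hY0])
  have hXsq : Integrable (fun p => ‖X p.1‖ ^ 2) (μ.prod ν) :=
    (hX.comp_fst ν).integrable_norm_pow two_ne_zero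
  have hYsq : Integrable (fun p => ‖Y p.2‖ ^ 2) (μ.prod ν) :=
    (hY.comp_snd μ).integrable_norm_pow two_ne_zero
  have hinner : Integrable (fun p => 2 * ⟪X p.1, Y p.2⟫_ℝ) (μ.prod ν) :=
    (hXi.op_fst_snd (by fun_prop) ⟨1, by simpa using abs_real_inner_le_norm⟩ hYi).const_mul 2
  simp_rw [norm_add_sq_real]
  rw [integral_add (by exact hXsq.add hinner) hYsq, integral_add hXsq hinner,
    integral_const_mul, hcross, integral_fun_fst (‖X ·‖ ^ 2), integral_fun_snd (‖Y ·‖ ^ 2)]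
  simp

end SecondMoment

section Gaussian

open scoped InnerProductSpace

variable {ι E : Type*} [Fintype ι] [DecidableEq ι] [NormedAddCommGroup E]
  {S : Matrix ι ι ℝ}

theorem memLp_eval_multivariateGaussian (m : EuclideanSpace ℝ ι) (S : Matrix ι ι ℝ) (i : ι) :
    MemLp (fun x : EuclideanSpace ℝ ι => x i) 2 (multivariateGaussian m S) :=
  IsGaussian.memLp_dual _ (EuclideanSpace.proj i : EuclideanSpace ℝ ι →L[ℝ] ℝ) 2 (by simp)

theorem integral_eval_multivariateGaussian (m : EuclideanSpace ℝ ι) (S : Matrix ι ι ℝ) (i : ι) :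
    ∫ x, x i ∂(multivariateGaussian m S) = m i := by
  simpa using (EuclideanSpace.proj i : EuclideanSpace ℝ ι →L[ℝ] ℝ).integral_comp_comm
    (IsGaussian.integrable_fun_id (μ := multivariateGaussian m S))

theorem integral_eval_mul_eval_multivariateGaussian_zero (hS : S.PosSemidef) (i j : ι) :
    ∫ x, x i * x j ∂(multivariateGaussian (0 : EuclideanSpace ℝ ι) S) = S i j := by
  simpa [covariance_eq_sub (memLp_eval_multivariateGaussian _ S i)
    (memLp_eval_multivariateGaussian _ S j), integral_eval_multivariateGaussian]
    using covariance_eval_multivariateGaussian (μ := (0 : EuclideanSpace ℝ ι)) hS i j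

theorem memLp_sum_smul_multivariateGaussian [NormedSpace ℝ E] (m : EuclideanSpace ℝ ι)
    (S : Matrix ι ι ℝ) (v : ι → E) :
    MemLp (fun x : EuclideanSpace ℝ ι => ∑ i, x i • v i) 2 (multivariateGaussian m S) :=
  memLp_finsetSum _ fun i _ =>
    (memLp_const (v i)).smul (p := 2) (q := ⊤) (memLp_eval_multivariateGaussian m S i)

theorem integral_sum_smul_multivariateGaussian [NormedSpace ℝ E] [CompleteSpace E]
    (m : EuclideanSpace ℝ ι) (S : Matrix ι ι ℝ) (v : ι → E) :
    ∫ x, ∑ i, x i • v i ∂(multivariateGaussian m S) = ∑ i, m i • v i := by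
  have hint (i : ι) := (memLp_eval_multivariateGaussian m S i).integrable one_le_two
  rw [integral_finsetSum _ fun i _ => (hint i).smul_const (v i)]
  simp_rw [integral_smul_const, integral_eval_multivariateGaussian]

theorem integral_sq_norm_sum_smul_multivariateGaussian_zero [InnerProductSpace ℝ E]
    (hS : S.PosSemidef) (v : ι → E) :
    ∫ x, ‖∑ i, x i • v i‖ ^ 2 ∂(multivariateGaussian (0 : EuclideanSpace ℝ ι) S) =
      ∑ i, ∑ j, S i j * ⟪v i, v j⟫_ℝ := by
  have hint (i j : ι) : Integrable (fun x : EuclideanSpace ℝ ι => x i * x j * ⟪v i, v j⟫_ℝ)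
      (multivariateGaussian 0 S) :=
    ((memLp_eval_multivariateGaussian _ S i).integrable_mul
      (memLp_eval_multivariateGaussian _ S j)).mul_const _
  simp_rw [← real_inner_self_eq_norm_sq, sum_inner, inner_sum, real_inner_smul_left,
    real_inner_smul_right, ← mul_assoc]
  rw [integral_finsetSum _ fun i _ => integrable_finsetSum _ fun j _ => hint i j]
  simp_rw [integral_finsetSum _ fun j _ => hint _ j, integral_mul_const,
    integral_eval_mul_eval_multivariateGaussian_zero hS]

end Gaussian

section ComplexGaussian

open scoped InnerProductSpace

variable {M : ℕ} {R : Matrix (Fin M) (Fin M) ℝ}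

theorem measurable_complex_of_parts : Measurable
    fun (p : EuclideanSpace ℝ (Fin M) × EuclideanSpace ℝ (Fin M)) (j : Fin M) =>
      (⟨p.1 j, p.2 j⟩ : ℂ) := by
  refine measurable_pi_lambda _ fun j => ?_
  have hparts : Measurable fun p : EuclideanSpace ℝ (Fin M) × EuclideanSpace ℝ (Fin M) =>
      (p.1 j, p.2 j) := by fun_prop
  exact Complex.measurableEquivRealProd.symm.measurable.comp hparts

instance isProbabilityMeasure_complexGaussian (R : Matrix (Fin M) (Fin M) ℝ) :
    IsProbabilityMeasure (complexGaussian R) :=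
  Measure.isProbabilityMeasure_map measurable_complex_of_parts.aemeasurable

theorem sum_mul_complex_of_parts (w : Fin M → ℂ) (x y : EuclideanSpace ℝ (Fin M)) :
    ∑ j, w j * ⟨x j, y j⟩ = ∑ j, x j • w j + ∑ j, y j • (Complex.I * w j) := by
  rw [← Finset.sum_add_distrib]
  refine Finset.sum_congr rfl fun j _ => ?_
  rw [Complex.mk_eq_add_mul_I, Complex.real_smul, Complex.real_smul]
  ring

theorem memLp_sum_mul_complexGaussian (R : Matrix (Fin M) (Fin M) ℝ) (w : Fin M → ℂ) :
    MemLp (fun z : Fin M → ℂ => ∑ j, w j * z j) 2 (complexGaussian R) := by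
  have hcont : Continuous fun z : Fin M → ℂ => ∑ j, w j * z j := by fun_prop
  rw [complexGaussian, memLp_map_measure_iff hcont.aestronglyMeasurable
    measurable_complex_of_parts.aemeasurable]
  simp only [Function.comp_def, sum_mul_complex_of_parts]
  have hre := (memLp_sum_smul_multivariateGaussian 0 ((1 / 2 : ℝ) • R) w).comp_fst
    (multivariateGaussian 0 ((1 / 2 : ℝ) • R))
  have him := (memLp_sum_smul_multivariateGaussian 0 ((1 / 2 : ℝ) • R) (Complex.I * w ·)).comp_snd
    (multivariateGaussian 0 ((1 / 2 : ℝ) • R))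
  exact hre.add him

theorem integral_complexGaussian {F : Type*} [NormedAddCommGroup F] [NormedSpace ℝ F]
    {g : (Fin M → ℂ) → F} (hg : StronglyMeasurable g) :
    ∫ z, g z ∂(complexGaussian R) = ∫ p : EuclideanSpace ℝ (Fin M) × EuclideanSpace ℝ (Fin M),
      g (fun j => ⟨p.1 j, p.2 j⟩) ∂((multivariateGaussian 0 ((1 / 2 : ℝ) • R)).prod
          (multivariateGaussian 0 ((1 / 2 : ℝ) • R))) :=
  integral_map measurable_complex_of_parts.aemeasurable hg.aestronglyMeasurable

theorem integral_sum_mul_complexGaussian (R : Matrix (Fin M) (Fin M) ℝ) (w : Fin M → ℂ) :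
    ∫ z, ∑ j, w j * z j ∂(complexGaussian R) = 0 := by
  rw [integral_complexGaussian (Continuous.stronglyMeasurable (by fun_prop))]
  simp_rw [sum_mul_complex_of_parts]
  rw [integral_add (((memLp_sum_smul_multivariateGaussian _ _ _).comp_fst _).integrable one_le_two)
    (((memLp_sum_smul_multivariateGaussian _ _ _).comp_snd _).integrable one_le_two),
    integral_fun_fst (fun x : EuclideanSpace ℝ (Fin M) => ∑ j, x j • w j),
    integral_fun_snd (fun y : EuclideanSpace ℝ (Fin M) => ∑ j, y j • (Complex.I * w j)),
    integral_sum_smul_multivariateGaussian, integral_sum_smul_multivariateGaussian]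
  simp

theorem integral_sq_norm_sum_mul_complexGaussian (hR : R.PosSemidef) (w : Fin M → ℂ) :
    ∫ z, ‖∑ j, w j * z j‖ ^ 2 ∂(complexGaussian R) = ∑ i, ∑ j, R i j * ⟪w i, w j⟫_ℝ := by
  have hhalf : ((1 / 2 : ℝ) • R).PosSemidef := hR.smul (by norm_num)
  have hrotate (i j : Fin M) : ⟪Complex.I * w i, Complex.I * w j⟫_ℝ = ⟪w i, w j⟫_ℝ := by
    rw [Complex.inner, Complex.inner, map_mul, mul_mul_mul_comm]
    simp
  rw [integral_complexGaussian (Continuous.stronglyMeasurable (by fun_prop))]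
  simp_rw [sum_mul_complex_of_parts]
  rw [integral_sq_norm_add_prod (memLp_sum_smul_multivariateGaussian _ _ _)
    (memLp_sum_smul_multivariateGaussian _ _ _)
    ((integral_sum_smul_multivariateGaussian _ _ _).trans (by simp)),
    integral_sq_norm_sum_smul_multivariateGaussian_zero hhalf,
    integral_sq_norm_sum_smul_multivariateGaussian_zero hhalf]
  simp_rw [hrotate, ← Finset.sum_add_distrib]
  refine Finset.sum_congr rfl fun i _ => Finset.sum_congr rfl fun j _ => ?_
  rw [Matrix.smul_apply, smul_eq_mul]
  ring

end ComplexGaussian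

section Energy

open scoped InnerProductSpace

variable {M : ℕ} {ψ : ℕ → ℝ} {R : Matrix (Fin M) (Fin M) ℝ} {β κ φ₀ : ℝ}

instance isProbabilityMeasure_cond_Icc_two_pi :
    IsProbabilityMeasure (cond (volume : Measure ℝ) (Set.Icc 0 (2 * Real.pi))) :=
  cond_isProbabilityMeasure_of_finite (by simp [Real.pi_pos]) measure_Icc_lt_top.ne

theorem integral_cond_Icc_two_pi {E : Type*} [NormedAddCommGroup E] [NormedSpace ℝ E] (g : ℝ → E) :
    ∫ φ, g φ ∂(cond (volume : Measure ℝ) (Set.Icc 0 (2 * Real.pi))) =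
      (1 / (2 * Real.pi)) • ∫ φ in (0 : ℝ)..(2 * Real.pi), g φ := by
  rw [ProbabilityTheory.cond, integral_smul_measure, integral_Icc_eq_integral_Ioc,
    intervalIntegral.integral_of_le Real.two_pi_pos.le, Real.volume_Icc, sub_zero,
    ENNReal.toReal_inv, ENNReal.toReal_ofReal Real.two_pi_pos.le, one_div]

theorem memLp_const_mul_steeringSum (M : ℕ) (ψ : ℕ → ℝ) (a : ℂ) :
    MemLp (fun φ => a * steeringSum M ψ φ) 2
      (cond (volume : Measure ℝ) (Set.Icc 0 (2 * Real.pi))) :=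
  (MemLp.of_bound (continuous_steeringSum M ψ).aestronglyMeasurable M
    (.of_forall (norm_steeringSum_le M ψ))).const_mul a

theorem integrable_sq_norm_steeringSum_add (R : Matrix (Fin M) (Fin M) ℝ) (ψ : ℕ → ℝ) (a : ℂ)
    (w : Fin M → ℂ) :
    Integrable (fun p => ‖a * steeringSum M ψ p.1 + ∑ j, w j * p.2 j‖ ^ 2) (jointLaw R) :=
  (((memLp_const_mul_steeringSum M ψ a).comp_fst _).add
    ((memLp_sum_mul_complexGaussian R w).comp_snd _)).integrable_norm_pow two_ne_zero

theorem integral_sq_norm_steeringSum_add (hM : 1 ≤ M) (hR : R.PosSemidef) (h0 : ψ 0 = 0) (a : ℂ)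
    (w : Fin M → ℂ) :
    ∫ p, ‖a * steeringSum M ψ p.1 + ∑ j, w j * p.2 j‖ ^ 2 ∂(jointLaw R) =
      ‖a‖ ^ 2 * fAvg M ψ + ∑ i, ∑ j, R i j * ⟪w i, w j⟫_ℝ := by
  rw [jointLaw, integral_sq_norm_add_prod (memLp_const_mul_steeringSum M ψ a)
    (memLp_sum_mul_complexGaussian R w) (integral_sum_mul_complexGaussian R w),
    integral_sq_norm_sum_mul_complexGaussian hR]
  simp_rw [norm_mul, mul_pow, sq_norm_steeringSum hM h0]
  rw [integral_const_mul, integral_cond_Icc_two_pi, smul_eq_mul, ← fAvg]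

theorem integral_sq_norm_rician (hM : 1 ≤ M) (hκ : 0 ≤ κ) (hR : R.PosSemidef) (h0 : ψ 0 = 0)
    (φ₀ : ℝ) (θ : Fin M → ℝ) :
    ∫ p, ‖(Real.sqrt (κ / (1 + κ)) : ℂ) * Complex.exp (Complex.I * φ₀) * steeringSum M ψ p.1
        + ∑ j, Real.sqrt (1 / (1 + κ)) * Complex.exp (Complex.I * θ j) * p.2 j‖ ^ 2
        ∂(jointLaw R) =
      1 / (κ + 1) * (∑ i, ∑ j, R i j * Real.cos (θ i - θ j) + κ * fAvg M ψ) := by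
  have hlos : ‖(Real.sqrt (κ / (1 + κ)) : ℂ) * Complex.exp (Complex.I * φ₀)‖ ^ 2 =
      κ / (1 + κ) := by
    rw [norm_mul, norm_exp_I_mul_ofReal, mul_one, Complex.norm_real, Real.norm_eq_abs, sq_abs,
      Real.sq_sqrt (by positivity)]
  have hscattering (i j : Fin M) : ⟪Real.sqrt (1 / (1 + κ)) * Complex.exp (Complex.I * θ i),
      Real.sqrt (1 / (1 + κ)) * Complex.exp (Complex.I * θ j)⟫_ℝ =
        1 / (1 + κ) * Real.cos (θ i - θ j) := by
    rw [← Complex.real_smul, ← Complex.real_smul, real_inner_smul_left, real_inner_smul_right,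
      inner_exp_I_mul_ofReal, ← mul_assoc, Real.mul_self_sqrt (by positivity)]
  rw [integral_sq_norm_steeringSum_add hM hR h0, hlos]
  simp_rw [hscattering, mul_left_comm (R _ _), ← Finset.mul_sum]
  ring

theorem sum_equivChannel (κ φ₀ : ℝ) (ψ : ℕ → ℝ) (φ : ℝ) (z : Fin M → ℂ) :
    ∑ j, equivChannel κ φ₀ ψ φ z j =
      (Real.sqrt (κ / (1 + κ)) : ℂ) * Complex.exp (Complex.I * φ₀) * steeringSum M ψ φ
        + ∑ j, Real.sqrt (1 / (1 + κ)) * z j := by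
  simp only [equivChannel, steeringSum, Finset.sum_add_distrib, Finset.mul_sum,
    Finset.sum_range]

theorem sum_applyPsi_channel (κ φ₀ : ℝ) (ψ : ℕ → ℝ) (φ : ℝ) (z : Fin M → ℂ) :
    ∑ j, applyPsi ψ (channel κ φ₀ φ z) j =
      (Real.sqrt (κ / (1 + κ)) : ℂ) * Complex.exp (Complex.I * φ₀) * steeringSum M ψ φ
        + ∑ j : Fin M, Real.sqrt (1 / (1 + κ)) * Complex.exp (Complex.I * ψ j) * z j := by
  simp only [applyPsi, channel, steeringSum, Finset.mul_sum, Finset.sum_range,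
    ← Finset.sum_add_distrib]
  refine Finset.sum_congr rfl fun j _ => ?_
  rw [Complex.ofReal_add, mul_add Complex.I, Complex.exp_add]
  ring

theorem integrable_rfEnergy_equivChannel (β κ φ₀ : ℝ) (R : Matrix (Fin M) (Fin M) ℝ)
    (ψ : ℕ → ℝ) :
    Integrable (fun p : ℝ × (Fin M → ℂ) => rfEnergy β (equivChannel κ φ₀ ψ p.1 p.2))
      (jointLaw R) := by
  simp_rw [rfEnergy, sum_equivChannel]
  exact (integrable_sq_norm_steeringSum_add R ψ _ fun _ => _).const_mul _

theorem avgRFEnergy_eq (hM : 1 ≤ M) (hκ : 0 ≤ κ) (hR : R.PosSemidef) (h0 : ψ 0 = 0) :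
    avgRFEnergy β κ φ₀ R ψ =
      β / ((M : ℝ) * (κ + 1)) * ((∑ i, ∑ j, R i j) + κ * fAvg M ψ) := by
  have h := integral_sq_norm_rician hM hκ hR h0 φ₀ 0
  simp only [Pi.zero_apply, Complex.ofReal_zero, mul_zero, Complex.exp_zero, mul_one, sub_self,
    Real.cos_zero] at h
  simp_rw [avgRFEnergy, rfEnergy, sum_equivChannel]
  rw [integral_const_mul, h, ← mul_assoc, div_mul_div_comm, mul_one]

theorem integral_rfEnergy_applyPsi_channel (hM : 1 ≤ M) (hκ : 0 ≤ κ) (hR : R.PosSemidef)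
    (hdiag : R.IsDiag) (h0 : ψ 0 = 0) :
    ∫ p, rfEnergy β (applyPsi ψ (channel κ φ₀ p.1 p.2)) ∂(jointLaw R) =
      avgRFEnergy β κ φ₀ R ψ := by
  have hcos (i j : Fin M) : R i j * Real.cos (ψ i - ψ j) = R i j := by
    rcases eq_or_ne i j with rfl | hij
    · simp
    · simp [hdiag hij]
  simp_rw [avgRFEnergy_eq hM hκ hR h0, rfEnergy, sum_applyPsi_channel]
  rw [integral_const_mul, integral_sq_norm_rician hM hκ hR h0 φ₀ fun j => ψ j, ← mul_assoc,
    div_mul_div_comm, mul_one]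
  simp_rw [hcos]

theorem isMaxOn_avgRFEnergy_of_isMaxOn_fAvg (hM : 1 ≤ M) (hβ : 0 ≤ β) (hκ : 0 ≤ κ)
    (hR : R.PosSemidef) (hψ : ψ ∈ admissible M) (hmax : IsMaxOn (fAvg M) (admissible M) ψ) :
    IsMaxOn (avgRFEnergy β κ φ₀ R) (admissible M) ψ := by
  intro ψ' hψ'
  rw [Set.mem_ofPred_eq, avgRFEnergy_eq hM hκ hR hψ'.1, avgRFEnergy_eq hM hκ hR hψ.1]
  gcongr
  exact hmax hψ'

theorem isMaxOn_avgRFEnergy_iff (hM : 1 ≤ M) (hβ : 0 < β) (hκ : 0 < κ) (hR : R.PosSemidef)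
    (hψ : ψ ∈ admissible M) :
    IsMaxOn (avgRFEnergy β κ φ₀ R) (admissible M) ψ ↔ IsMaxOn (fAvg M) (admissible M) ψ := by
  refine forall₂_congr fun ψ' hψ' => ?_
  have : (0 : ℝ) < M := by exact_mod_cast hM
  rw [Set.mem_ofPred_eq, Set.mem_ofPred_eq, avgRFEnergy_eq hM hκ.le hR hψ'.1,
    avgRFEnergy_eq hM hκ.le hR hψ.1, mul_le_mul_iff_of_pos_left (by positivity),
    add_le_add_iff_left, mul_le_mul_iff_of_pos_left hκ]

end Energy

end AASS

theorem mainTheorem3 (M : ℕ) (hM : 1 ≤ M) :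
    -- closed form of the average over the azimuth
    (∀ ψ : ℕ → ℝ, AASS.fAvg M ψ =
      (M : ℝ) + 2 * ∑ t ∈ Finset.Icc 1 (M - 1), AASS.J0 ((t : ℝ) * Real.pi) * Real.cos (ψ t)
        + 2 * ∑ t ∈ Finset.Icc 1 (M - 2), ∑ l ∈ Finset.Icc (t + 1) (M - 1),
            AASS.J0 (((t : ℝ) - (l : ℝ)) * Real.pi) * Real.cos (ψ t - ψ l)) ∧
    -- upper bound, attained by the alternating phases, which are a maximizer
    (∀ ψ : ℕ → ℝ, AASS.fAvg M ψ ≤ AASS.fUpper M) ∧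
    AASS.fAvg M AASS.psiOpt = AASS.fUpper M ∧
    AASS.psiOpt ∈ AASS.admissible M ∧
    IsMaxOn (AASS.fAvg M) (AASS.admissible M) AASS.psiOpt ∧
    -- the maximizers are exactly the phase vectors with a shift of `π` between neighbours
    (∀ ψ ∈ AASS.admissible M,
      IsMaxOn (AASS.fAvg M) (AASS.admissible M) ψ ↔ AASS.ConsecutivePiShifted M ψ) ∧
    -- average incident RF energy
    (∀ (β κ φ₀ : ℝ) (R : Matrix (Fin M) (Fin M) ℝ), 0 < β → 0 ≤ κ → R.PosSemidef →
      (∀ ψ ∈ AASS.admissible M,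
        MeasureTheory.Integrable
          (fun p : ℝ × (Fin M → ℂ) => AASS.rfEnergy β (AASS.equivChannel κ φ₀ ψ p.1 p.2))
          (AASS.jointLaw R) ∧
        AASS.avgRFEnergy β κ φ₀ R ψ =
          β / ((M : ℝ) * (κ + 1)) * ((∑ i, ∑ j, R i j) + κ * AASS.fAvg M ψ)) ∧
      IsMaxOn (AASS.avgRFEnergy β κ φ₀ R) (AASS.admissible M) AASS.psiOpt ∧
      (0 < κ → ∀ ψ ∈ AASS.admissible M,
        (IsMaxOn (AASS.avgRFEnergy β κ φ₀ R) (AASS.admissible M) ψ ↔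
          AASS.ConsecutivePiShifted M ψ)) ∧
      -- for uncorrelated scattering, the equivalent channel gives the energy of `Ψ h` itself
      (R.IsDiag → ∀ ψ ∈ AASS.admissible M,
        ∫ p, AASS.rfEnergy β (AASS.applyPsi ψ (AASS.channel κ φ₀ p.1 p.2)) ∂(AASS.jointLaw R) =
          AASS.avgRFEnergy β κ φ₀ R ψ)) := by
  refine ⟨AASS.fAvg_eq hM, AASS.fAvg_le_fUpper hM, AASS.fAvg_psiOpt hM,
    AASS.psiOpt_mem_admissible M, AASS.isMaxOn_fAvg_psiOpt hM,
    fun ψ hψ => AASS.isMaxOn_fAvg_iff hM hψ, fun β κ φ₀ R hβ hκ hR => ⟨?_, ?_, ?_, ?_⟩⟩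
  · exact fun ψ hψ =>
      ⟨AASS.integrable_rfEnergy_equivChannel β κ φ₀ R ψ, AASS.avgRFEnergy_eq hM hκ hR hψ.1⟩
  · exact AASS.isMaxOn_avgRFEnergy_of_isMaxOn_fAvg hM hβ.le hκ hR (AASS.psiOpt_mem_admissible M)
      (AASS.isMaxOn_fAvg_psiOpt hM)
  · exact fun hκ ψ hψ =>
      (AASS.isMaxOn_avgRFEnergy_iff hM hβ hκ hR hψ).trans (AASS.isMaxOn_fAvg_iff hM hψ)
  · exact fun hdiag ψ hψ => AASS.integral_rfEnergy_applyPsi_channel hM hκ hR hdiag hψ.1
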